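/- Let $\mathcal H$ be a complex separable Hilbert space with inner product $\langle\cdot,\cdot\rangle$ (linear in the second argument) and let $A$ be a trace class operator on $\mathcal H$, that is, a compact operator for which the sum of its singular values (the positive eigenvalues of $|A|=(A^*A)^{1/2}$, counted with multiplicity) is finite. The determinant of $I+zT$, $z\in\mathbb C$, is $$\det(I+zT)=\sum_{n=0}^\infty z^n\,\mathrm{tr}\,{\textstyle\bigwedge^n}(T),\qquad \mathrm{tr}\,{\textstyle\bigwedge^n}(T)=\sum_{S\subset\iota,\ |S|=n}\det\big(\langle e_i,Te_j\rangle\big)_{i,j\in S},$$ evaluated in an arbitrary orthonormal basis $(e_i)_{i\in\iota}$ of $\mathcal H$. Let $(V_m)$ be a sequence of finite-dimensional subspaces of $\mathcal H$ with orthogonal projections $P_m:\mathcal H\to V_m$. Assume that $\bigcup_m V_m$ is dense in $\mathcal H$ and that the subspaces are nested, $V_m\subset V_{m+1}$ for all $m$, or, more generally, that $P_mx\to x$ for every $x\in\mathcal H$. Then all the series above converge absolutely for $T=A$ and for $T=P_mAP_m$; for every $m$, every orthonormal basis $\phi_1,\dots,\phi_d$ of $V_m$ and every $z\in\mathbb C$,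 $$\det(I+z\,P_mAP_m)=\det\big(\delta_{ij}+z\,\langle\phi_i,A\phi_j\rangle\big)_{i,j=1}^d;$$ and $$\det(I+z\,P_mAP_m)\to\det(I+z\,A)\qquad(m\to\infty)$$ uniformly for $z$ in any bounded subset of $\mathbb C$. -/

import Mathlib

noncomputable section

namespace FredholmDet

variable {H : Type*} [NormedAddCommGroup H] [InnerProductSpace ℂ H]
variable {ι : Type*}

/-- The multiplicity of the number `s > 0` as a singular value of `A`, that is, the dimension of
the eigenspace of `|A| = (A* A)^{1/2}` for `s`. For a compact operator `A` this eigenspace is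
finite-dimensional. -/
def singularMultiplicity [CompleteSpace H] (A : H →L[ℂ] H) (s : ℝ) : ℕ :=
  Module.finrank ℂ
    (Module.End.eigenspace ((CFC.abs A : H →L[ℂ] H) : H →ₗ[ℂ] H) (s : ℂ))

/-- Trace class operators: compact operators whose singular values (the positive eigenvalues
of `|A|`, counted with multiplicity) have a finite sum. -/
def IsTraceClass [CompleteSpace H] (A : H →L[ℂ] H) : Prop :=
  IsCompactOperator A ∧
    Summable fun s : {s : ℝ // 0 < s} => (s : ℝ) * (singularMultiplicity A s : ℝ)

open Classical in
/-- The principal minor `det (⟨eᵢ, A eⱼ⟩)` with `i, j ∈ S`. With `S = {i₁, …, iₙ}` and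
`e_S = e_{i₁} ∧ ⋯ ∧ e_{iₙ}`, this is the diagonal matrix element `⟨e_S, Λⁿ(A) e_S⟩`
of the exterior power `Λⁿ(A)`; see `pairing_exteriorPower_eq_principalMinor`. -/
def principalMinor (e : HilbertBasis ι ℂ H) (A : H →L[ℂ] H) (S : Finset ι) : ℂ :=
  Matrix.det (Matrix.of fun i j : S => inner ℂ (e i) (A (e j)))

/-- The `e_S`-coordinate of `Λⁿ(A) e_S` is the principal minor of `A` on `S`. -/
theorem pairing_exteriorPower_eq_principalMinor (e : HilbertBasis ι ℂ H) (A : H →L[ℂ] H)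
    {n : ℕ} (S : Finset ι) (i : Fin n ≃ S) :
    exteriorPower.pairingDual ℂ H n
        (exteriorPower.ιMulti ℂ n
          fun p => ((innerSL ℂ (e (i p)) : H →L[ℂ] ℂ) : Module.Dual ℂ H))
        (exteriorPower.map n (A : H →ₗ[ℂ] H)
          (exteriorPower.ιMulti ℂ n fun p => e (i p))) =
      principalMinor e A S := by
  classical
  rw [exteriorPower.map_apply_ιMulti, exteriorPower.pairingDual_ιMulti_ιMulti, principalMinor,
    ← Matrix.det_transpose, ← Matrix.det_submatrix_equiv_self i]
  congr 1

/-- The trace of the `n`-th exterior power `Λⁿ(A)`, evaluated in the orthonormal basis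
`e_S`, `S` ranging over the `n`-element subsets of `ι`, of `Λⁿ(H)`. -/
def traceExteriorPower (e : HilbertBasis ι ℂ H) (A : H →L[ℂ] H) (n : ℕ) : ℂ :=
  ∑' S : Set.powersetCard ι n, principalMinor e A (S : Finset ι)

/-- The operator determinant `det (I + z A) = ∑ₙ zⁿ tr Λⁿ(A)`, the traces being evaluated by means
of the orthonormal basis `e`. -/
def operatorDet (e : HilbertBasis ι ℂ H) (A : H →L[ℂ] H) (z : ℂ) : ℂ :=
  ∑' n : ℕ, z ^ n * traceExteriorPower e A n

/-- All series entering `operatorDet e A` converge (absolutely). -/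
def OperatorDetConverges (e : HilbertBasis ι ℂ H) (A : H →L[ℂ] H) : Prop :=
  (∀ n : ℕ, Summable fun S : Set.powersetCard ι n => principalMinor e A (S : Finset ι)) ∧
    ∀ z : ℂ, Summable fun n : ℕ => z ^ n * traceExteriorPower e A n

/-- The Galerkin projection `P A P`, where `P` is the orthogonal projection onto `V`. -/
def galerkinProjection (V : Submodule ℂ H) [V.HasOrthogonalProjection] (A : H →L[ℂ] H) :
    H →L[ℂ] H :=
  V.starProjection ∘L A ∘L V.starProjection

end FredholmDet

end

/-! The singular vectors give `A = ∑ₖ ⟨uₖ, ·⟩ xₖ` with `u` orthonormal, `xₖ = A uₖ` and `C = ∑ₖ ‖xₖ‖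
< ∞` (`IsTraceClass.exists_expansion`). For any absolutely convergent expansion, Fubini and Parseval
turn `tr Λⁿ` into `(1/n!) ∑ det ⟨y_{k_a}, x_{k_b}⟩` over tuples `k`, with no trace of the basis `e`
left (`hasSum_principalMinor`).

`P A P` has the expansion with vectors `P xₖ`, `P uₖ`. As `⟨P u, P x⟩ = ⟨u, P x⟩`, Hadamard and
Bessel bound its determinants by `∏ ‖x_{k_a}‖`, uniformly in `P` (`Orthonormal.norm_det_inner_le`).
So all traces are at most `Cⁿ/n!`, and dominated convergence, over tuples and then over `n`, gives
the limit. The compression of `A` to `V_m` has the same inner products, hence the same determinant,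
which is a finite one. -/

/-! ### Products of series, Hadamard's and Bessel's inequalities. -/

/-- A product of absolutely convergent series is the sum over all choices of terms. -/
theorem summable_norm_prod_pi {κ : Type*} : ∀ (n : ℕ) (f : Fin n → κ → ℂ)
    (_ : ∀ a, Summable fun k => ‖f a k‖),
    Summable (fun k : Fin n → κ => ‖∏ a, f a (k a)‖) ∧
      ∑' k : Fin n → κ, ∏ a, f a (k a) = ∏ a, ∑' k, f a k := by
  intro n
  induction n with
  | zero =>
    intro f _
    refine ⟨(hasSum_fintype _).summable, ?_⟩
    simp
  | succ n ih =>
    intro f hf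
    obtain ⟨h1, h2⟩ := ih (fun a => f a.succ) fun a => hf a.succ
    let E : κ × (Fin n → κ) ≃ (Fin (n + 1) → κ) := Fin.consEquiv fun _ => κ
    have hE : ∀ p : κ × (Fin n → κ),
        ∏ a, f a (E p a) = f 0 p.1 * ∏ a : Fin n, f a.succ (p.2 a) := by
      intro p
      rw [Fin.prod_univ_succ]
      simp [E, Fin.consEquiv]
    constructor
    · rw [← E.summable_iff]
      have := Summable.mul_norm (hf 0) h1
      refine this.congr fun p => ?_
      simp only [Function.comp_apply, hE]
    · rw [← E.tsum_eq, Fin.prod_univ_succ, ← h2, tsum_mul_tsum_of_summable_norm (hf 0) h1]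
      exact tsum_congr hE

/-- **Hadamard's inequality** for the columns of a complex matrix. -/
theorem Matrix.norm_det_le_prod_sqrt {n : ℕ} (M : Matrix (Fin n) (Fin n) ℂ) :
    ‖M.det‖ ≤ ∏ b, Real.sqrt (∑ a, ‖M a b‖ ^ 2) := by
  let E := EuclideanSpace ℂ (Fin n)
  let f : Fin n → E := fun b => WithLp.toLp 2 fun a => M a b
  have hd : Module.finrank ℂ E = Fintype.card (Fin n) := finrank_euclideanSpace
  let g := InnerProductSpace.gramSchmidtOrthonormalBasis hd f
  let s := EuclideanSpace.basisFun (Fin n) ℂ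
  have h1 : s.toBasis.det f = M.det := by
    rw [Module.Basis.det_apply]
    congr 1
  have h2 : s.toBasis.det f = s.toBasis.det g.toBasis * g.toBasis.det f := by
    rw [Module.Basis.det_apply, Module.Basis.det_apply, Module.Basis.det_apply, ← Matrix.det_mul,
      Module.Basis.toMatrix_mul_toMatrix]
  have h3 : ‖s.toBasis.det g.toBasis‖ = 1 := by
    simp
  -- In the Gram–Schmidt basis the columns form a triangular matrix with diagonal `⟨g b, f b⟩`;
  -- Cauchy–Schwarz bounds each entry.
  rw [← h1, h2, norm_mul, h3, one_mul, InnerProductSpace.gramSchmidtOrthonormalBasis_det, norm_prod]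
  refine Finset.prod_le_prod (fun _ _ => norm_nonneg _) fun b _ => ?_
  refine (norm_inner_le_norm _ _).trans ?_
  rw [g.norm_eq_one, one_mul, EuclideanSpace.norm_eq]

section
variable {H : Type*} [NormedAddCommGroup H] [InnerProductSpace ℂ H] {ι κ : Type*}

/-- Column `b` holds Fourier coefficients of `x (k b)`, so Bessel bounds each factor in Hadamard's
inequality. A repeated index makes two rows equal. -/
theorem Orthonormal.norm_det_inner_le {y : κ → H} (hy : Orthonormal ℂ y) {n : ℕ} (x : κ → H)
    (k : Fin n → κ) :
    ‖Matrix.det (Matrix.of fun a b => inner ℂ (y (k a)) (x (k b)))‖ ≤ ∏ a, ‖x (k a)‖ := by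
  by_cases hk : Function.Injective k
  · refine (Matrix.norm_det_le_prod_sqrt _).trans ?_
    refine Finset.prod_le_prod (fun _ _ => Real.sqrt_nonneg _) fun b _ => ?_
    rw [Real.sqrt_le_left (norm_nonneg _)]
    exact (hy.comp k hk).sum_inner_products_le (x (k b))
  · obtain ⟨a, b, hab, hne⟩ := Function.not_injective_iff.mp hk
    rw [Matrix.det_zero_of_row_eq hne (by ext; simp [hab]), norm_zero]
    exact Finset.prod_nonneg fun _ _ => norm_nonneg _

theorem Orthonormal.summable_norm_inner_mul_inner {e : ι → H} (he : Orthonormal ℂ e) (u v : H) :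
    Summable (fun i => ‖inner ℂ (e i) u * inner ℂ v (e i)‖) ∧
      ∑' i, ‖inner ℂ (e i) u * inner ℂ v (e i)‖ ≤ ‖u‖ * ‖v‖ := by
  have h : ∀ s : Finset ι, ∑ i ∈ s, ‖inner ℂ (e i) u * inner ℂ v (e i)‖ ≤ ‖u‖ * ‖v‖ := by
    intro s
    simp_rw [norm_mul]
    refine (Real.sum_mul_le_sqrt_mul_sqrt _ _ _).trans ?_
    refine mul_le_mul ?_ ?_ (Real.sqrt_nonneg _) (norm_nonneg _)
    · rw [Real.sqrt_le_left (norm_nonneg _)]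
      exact he.sum_inner_products_le u
    · rw [Real.sqrt_le_left (norm_nonneg _)]
      simp_rw [norm_inner_symm v]
      exact he.sum_inner_products_le v
  exact ⟨summable_of_sum_le (fun _ => norm_nonneg _) h,
    Real.tsum_le_of_sum_le (fun _ => norm_nonneg _) h⟩

end

/-! ### Traces of exterior powers computed from an expansion. -/

namespace FredholmDet
open scoped Nat
variable {H : Type*} [NormedAddCommGroup H] [InnerProductSpace ℂ H] {ι κ : Type*}

/-- `A = ∑ₖ ⟨yₖ, ·⟩ xₖ` in the weak sense. -/
def HasExpansion (A : H →L[ℂ] H) (x y : κ → H) : Prop :=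
  ∀ w v : H, HasSum (fun k => inner ℂ w (x k) * inner ℂ (y k) v) (inner ℂ w (A v))

/-- The value of `tr Λⁿ(A)` read off from an expansion `A = ∑ₖ ⟨yₖ, ·⟩ xₖ`. -/
noncomputable def expansionTrace (x y : κ → H) (n : ℕ) : ℂ :=
  ((n ! : ℕ) : ℂ)⁻¹ *
    ∑' k : Fin n → κ, Matrix.det (Matrix.of fun a b => inner ℂ (y (k a)) (x (k b)))

/-- Fubini on `κⁿ × ιⁿ`: summing `G` over `k` restores `A`, summing over `i` removes the basis by
Parseval. This is the term of `σ` in the Leibniz formula. -/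
theorem hasSum_tuple_prod [CompleteSpace H] (e : HilbertBasis ι ℂ H) {A : H →L[ℂ] H} {x y : κ → H}
    (hA : HasExpansion A x y) (hxy : Summable fun k => ‖x k‖ * ‖y k‖) {n : ℕ}
    (σ : Equiv.Perm (Fin n)) :
    Summable (fun k : Fin n → κ => ∏ a, inner ℂ (y (k (σ a))) (x (k a))) ∧
    HasSum (fun i : Fin n → ι => ∏ a, inner ℂ (e (i (σ a))) (A (e (i a))))
      (∑' k : Fin n → κ, ∏ a, inner ℂ (y (k (σ a))) (x (k a))) := by
  let G : (Fin n → κ) × (Fin n → ι) → ℂ := fun p =>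
    ∏ a, inner ℂ (e (p.2 (σ a))) (x (p.1 a)) * inner ℂ (y (p.1 a)) (e (p.2 a))
  -- Reindexing by `σ` makes each factor depend on a single `i a`, so the sum over `i` factors.
  have hG : ∀ k i, G (k, i) =
      ∏ a, inner ℂ (e (i a)) (x (k (σ.symm a))) * inner ℂ (y (k a)) (e (i a)) := by
    intro k i
    simp only [G, Finset.prod_mul_distrib]
    congr 1
    rw [← Equiv.prod_comp σ (fun a => inner ℂ (e (i a)) (x (k (σ.symm a))))]
    simp
  have hyx : ∀ k : Fin n → κ, ∏ a, inner ℂ (y (k a)) (x (k (σ.symm a))) =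
      ∏ a, inner ℂ (y (k (σ a))) (x (k a)) := by
    intro k
    rw [← Equiv.prod_comp σ (fun a => inner ℂ (y (k a)) (x (k (σ.symm a))))]
    simp
  have hbound : Summable fun k : Fin n → κ => ∏ a, ‖x (k a)‖ * ‖y (k a)‖ := by
    have := (summable_norm_prod_pi n (fun _ k => ((‖x k‖ * ‖y k‖ : ℝ) : ℂ))
      (fun _ => by simpa using hxy)).1
    simpa using this
  have hin : ∀ k : Fin n → κ, Summable (fun i => ‖G (k, i)‖) ∧
      ∑' i, ‖G (k, i)‖ ≤ ∏ a, ‖x (k a)‖ * ‖y (k a)‖ := by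
    intro k
    have h1 := fun a => e.orthonormal.summable_norm_inner_mul_inner (x (k (σ.symm a))) (y (k a))
    have h2 := summable_norm_prod_pi n (fun a i => ((‖inner ℂ (e i) (x (k (σ.symm a))) *
      inner ℂ (y (k a)) (e i)‖ : ℝ) : ℂ)) (fun a => by simpa using (h1 a).1)
    have h3 : ∑' i, ‖G (k, i)‖ = ∏ a, ∑' i, ‖inner ℂ (e i) (x (k (σ.symm a))) *
      inner ℂ (y (k a)) (e i)‖ := by
      have := h2.2
      simp only [← Complex.ofReal_prod, ← Complex.ofReal_tsum] at this
      rw [← Complex.ofReal_inj.mp this]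
      exact tsum_congr fun i => by rw [hG, norm_prod]
    constructor
    · refine h2.1.congr fun i => ?_
      rw [hG]; simp
    · rw [h3]
      refine (Finset.prod_le_prod (fun _ _ => tsum_nonneg fun _ => norm_nonneg _)
        fun a _ => (h1 a).2).trans_eq ?_
      simp only [Finset.prod_mul_distrib]
      rw [Equiv.prod_comp σ.symm (fun a => ‖x (k a)‖)]
  have hGs : Summable fun p => ‖G p‖ := by
    rw [summable_prod_of_nonneg fun p => norm_nonneg _]
    exact ⟨fun k => (hin k).1, hbound.of_nonneg_of_le
      (fun k => tsum_nonneg fun _ => norm_nonneg _) fun k => (hin k).2⟩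
  have hG' : Summable G := hGs.of_norm
  have hsumi : ∀ k, ∑' i, G (k, i) = ∏ a, inner ℂ (y (k (σ a))) (x (k a)) := by
    intro k
    simp_rw [hG]
    rw [(summable_norm_prod_pi n (fun a i => inner ℂ (e i) (x (k (σ.symm a))) *
      inner ℂ (y (k a)) (e i)) fun a => (e.orthonormal.summable_norm_inner_mul_inner _ _).1).2,
      ← hyx]
    refine Finset.prod_congr rfl fun a _ => ?_
    rw [← (e.hasSum_inner_mul_inner (y (k a)) (x (k (σ.symm a)))).tsum_eq]
    exact tsum_congr fun i => mul_comm _ _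
  have hsumk : ∀ i : Fin n → ι, ∑' k, G (k, i) = ∏ a, inner ℂ (e (i (σ a))) (A (e (i a))) := by
    intro i
    rw [(summable_norm_prod_pi n (fun a k => inner ℂ (e (i (σ a))) (x k) *
      inner ℂ (y k) (e (i a))) fun a => (hA _ _).summable.norm).2]
    exact Finset.prod_congr rfl fun a _ => (hA _ _).tsum_eq
  have key := hG'.prod_symm.hasSum.prod_fiberwise fun i => (hG'.prod_symm.prod_factor i).hasSum
  refine ⟨hG'.prod.congr fun k => (hsumi k), ?_⟩
  have e1 : ∑' p : (Fin n → ι) × (Fin n → κ), G p.swap =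
      ∑' k : Fin n → κ, ∏ a, inner ℂ (y (k (σ a))) (x (k a)) := by
    rw [← tsum_congr hsumi, ← hG'.tsum_prod]
    exact (Equiv.prodComm _ _).tsum_eq G
  rw [e1] at key
  exact key.congr_fun fun i => (hsumk i).symm

theorem hasSum_tuple_det [CompleteSpace H] (e : HilbertBasis ι ℂ H) {A : H →L[ℂ] H} {x y : κ → H}
    (hA : HasExpansion A x y) (hxy : Summable fun k => ‖x k‖ * ‖y k‖) (n : ℕ) :
    HasSum (fun i : Fin n → ι => Matrix.det (Matrix.of fun a b => inner ℂ (e (i a)) (A (e (i b)))))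
      ((n ! : ℕ) * expansionTrace x y n) := by
  have h := fun σ : Equiv.Perm (Fin n) => hasSum_tuple_prod e hA hxy σ
  have h2 := hasSum_sum (s := Finset.univ) fun σ _ => (h σ).2.const_smul (Equiv.Perm.sign σ)
  rw [expansionTrace, mul_inv_cancel_left₀ (by exact_mod_cast n.factorial_ne_zero)]
  simp only [Matrix.det_apply, Matrix.of_apply]
  rw [Summable.tsum_finsetSum fun σ _ => (h σ).1.const_smul (Equiv.Perm.sign σ)]
  convert h2 using 2 with σ
  exact (h _).1.tsum_const_smul _

theorem det_tuple_eq_principalMinor (e : HilbertBasis ι ℂ H) (A : H →L[ℂ] H) {n : ℕ}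
    (f : Fin n ↪ ι) (S : Finset ι) (hS : Finset.univ.map f = S) :
    Matrix.det (Matrix.of fun a b => inner ℂ (e (f a)) (A (e (f b)))) = principalMinor e A S := by
  classical
  subst hS
  let g : Fin n ≃ (Finset.univ.map f : Finset ι) :=
    Equiv.ofBijective (fun a => ⟨f a, by simp⟩) ⟨fun a b h => by simpa using h, fun ⟨b, hb⟩ => by
      obtain ⟨a, -, rfl⟩ := Finset.mem_map.mp hb
      exact ⟨a, rfl⟩⟩
  rw [principalMinor, ← Matrix.det_submatrix_equiv_self g]
  congr!

theorem card_fiber_ofFinEmb {n : ℕ} (S : Set.powersetCard ι n) :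
    Nat.card {f : Fin n ↪ ι // Set.powersetCard.ofFinEmb n ι f = S} = n ! := by
  classical
  have hc : Fintype.card (S : Finset ι) = n := by simp [Set.powersetCard.card_eq S]
  have hS : ∀ f : Fin n ↪ ι, Set.powersetCard.ofFinEmb n ι f = S ↔
      Finset.univ.map f = (S : Finset ι) := fun f => by
    rw [← Set.powersetCard.val_ofFinEmb]; exact Subtype.ext_iff
  let E : {f : Fin n ↪ ι // Set.powersetCard.ofFinEmb n ι f = S} ≃ (Fin n ↪ (S : Finset ι)) :=
    { toFun := fun f => ⟨fun a => ⟨f.1 a, by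
          rw [← (hS f.1).mp f.2]; simp⟩, fun a b h => by simpa using h⟩
      invFun := fun g => ⟨g.trans (Function.Embedding.subtype _), (hS _).mpr (by
          refine Finset.eq_of_subset_of_card_le (fun i hi => ?_) (by simp [Set.powersetCard.card_eq S])
          obtain ⟨a, -, rfl⟩ := Finset.mem_map.mp hi
          exact (g a).2)⟩
      left_inv := fun f => by ext; rfl
      right_inv := fun g => by ext; rfl }
  rw [Nat.card_congr E, Nat.card_eq_fintype_card, Fintype.card_embedding_eq, hc, Fintype.card_fin,
    Nat.descFactorial_self]

/-- The trace of the exterior power of an operator with an absolutely convergent expansion. -/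
theorem hasSum_principalMinor [CompleteSpace H] (e : HilbertBasis ι ℂ H) {A : H →L[ℂ] H}
    {x y : κ → H} (hA : HasExpansion A x y) (hxy : Summable fun k => ‖x k‖ * ‖y k‖) (n : ℕ) :
    HasSum (fun S : Set.powersetCard ι n => principalMinor e A (S : Finset ι))
      (expansionTrace x y n) := by
  have h1 := hasSum_tuple_det e hA hxy n
  have h2 : HasSum (fun f : Fin n ↪ ι =>
      Matrix.det (Matrix.of fun a b => inner ℂ (e (f a)) (A (e (f b)))))
      ((n ! : ℕ) * expansionTrace x y n) := by
    -- Tuples with a repeated index have determinant zero, so only embeddings count.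
    refine (Function.Injective.hasSum_iff (f := fun i : Fin n → ι => Matrix.det
      (Matrix.of fun a b => inner ℂ (e (i a)) (A (e (i b))))) (g := fun f : Fin n ↪ ι => ⇑f)
      DFunLike.coe_injective ?_).mpr h1
    intro i hi
    have : ¬ Function.Injective i := fun h => hi ⟨⟨i, h⟩, rfl⟩
    obtain ⟨a, b, hab, hne⟩ := Function.not_injective_iff.mp this
    exact Matrix.det_zero_of_row_eq hne (by ext; simp [hab])
  rw [← (Equiv.sigmaFiberEquiv (Set.powersetCard.ofFinEmb n ι)).hasSum_iff] at h2
  -- Each `n`-element set is the range of `n!` embeddings, all giving the same minor.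
  have h3 := h2.sigma (g := fun S : Set.powersetCard ι n =>
    (n ! : ℕ) * principalMinor e A (S : Finset ι)) fun S => by
    have hfin : Finite {f : Fin n ↪ ι // Set.powersetCard.ofFinEmb n ι f = S} :=
      Nat.finite_of_card_ne_zero (by rw [card_fiber_ofFinEmb]; exact n.factorial_ne_zero)
    have := Fintype.ofFinite {f : Fin n ↪ ι // Set.powersetCard.ofFinEmb n ι f = S}
    convert hasSum_fintype _ using 1
    rw [← card_fiber_ofFinEmb S, Nat.card_eq_fintype_card, ← nsmul_eq_mul]
    refine (Finset.sum_eq_card_nsmul fun f _ => ?_).symm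
    refine det_tuple_eq_principalMinor e A f.1 _ ?_
    rw [← Set.powersetCard.val_ofFinEmb]
    exact congrArg Subtype.val f.2
  have h4 := h3.mul_left ((n ! : ℕ) : ℂ)⁻¹
  simpa [n.factorial_ne_zero] using h4

end FredholmDet

/-! ### Singular value expansion of a trace class operator. -/

open ContinuousLinearMap Module.End in
/-- The eigenspace of `|A|` for a positive number is the eigenspace of `A* A` for its square. -/
theorem FredholmDet.eigenspace_abs_eq {H : Type*} [NormedAddCommGroup H] [InnerProductSpace ℂ H]
    [CompleteSpace H] (A : H →L[ℂ] H) {s : ℝ} (hs : 0 < s) :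
    eigenspace ((CFC.abs A : H →L[ℂ] H) : H →ₗ[ℂ] H) (s : ℂ) =
      eigenspace ((adjoint A ∘L A : H →L[ℂ] H) : H →ₗ[ℂ] H) ((s ^ 2 : ℝ) : ℂ) := by
  have habs : ∀ v, CFC.abs A (CFC.abs A v) = (adjoint A ∘L A) v := fun v =>
    congrArg (fun T : H →L[ℂ] H => T v) (CFC.abs_mul_abs A)
  have hpos : (CFC.abs A : H →L[ℂ] H).IsPositive :=
    (ContinuousLinearMap.nonneg_iff_isPositive _).mp (CFC.abs_nonneg A)
  ext v
  rw [mem_eigenspace_iff, mem_eigenspace_iff]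
  simp only [coe_coe]
  rw [← habs]
  constructor
  · intro h
    rw [h, map_smul, h, smul_smul]
    push_cast
    rw [sq]
  · intro h
    -- `w` satisfies `|A| w = -s w`, which positivity of `|A|` allows only for `w = 0`.
    set w := CFC.abs A v - (s : ℂ) • v with hw
    have h1 : CFC.abs A w = -((s : ℂ) • w) := by
      rw [hw, map_sub, h, map_smul, smul_sub, smul_smul]
      push_cast
      rw [sq]; abel
    have h2 := hpos.re_inner_nonneg_right w
    rw [h1, inner_neg_right, inner_smul_right, inner_self_eq_norm_sq_to_K] at h2
    have h3 : 0 ≤ -(s * ‖w‖ ^ 2) := by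
      have : (-((s : ℂ) * ((‖w‖ : ℝ) : ℂ) ^ 2)).re = -(s * ‖w‖ ^ 2) := by
        norm_cast
      rw [← this]; exact h2
    have h4 : ‖w‖ = 0 := by
      by_contra h
      have : 0 < ‖w‖ := lt_of_le_of_ne (norm_nonneg _) (Ne.symm h)
      nlinarith [mul_pos hs (pow_pos this 2)]
    exact sub_eq_zero.mp (norm_eq_zero.mp h4)

open ContinuousLinearMap Module.End in
/-- A trace class operator has the expansion `A = ∑ₖ ⟨uₖ, ·⟩ A uₖ`, where the `uₖ` are the
eigenvectors of `|A|` for the singular values of `A`. -/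
theorem FredholmDet.IsTraceClass.exists_expansion {H : Type*} [NormedAddCommGroup H]
    [InnerProductSpace ℂ H] [CompleteSpace H] {A : H →L[ℂ] H} (hA : IsTraceClass A) :
    ∃ (κ : Type) (x u : κ → H), Orthonormal ℂ u ∧ (Summable fun k => ‖x k‖) ∧
      HasExpansion A x u := by
  obtain ⟨hc, hsum⟩ := hA
  set T : H →L[ℂ] H := adjoint A ∘L A with hT
  have hTc : IsCompactOperator T := hc.clm_comp (adjoint A)
  have hTpos : T.IsPositive := by
    simpa [hT] using ContinuousLinearMap.isPositive_adjoint_comp_self A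
  have hTs : (T : H →ₗ[ℂ] H).IsSymmetric := hTpos.isSymmetric
  have hAT : ∀ v, inner ℂ v (T v) = ((‖A v‖ ^ 2 : ℝ) : ℂ) := by
    intro v
    rw [hT, comp_apply, adjoint_inner_right, inner_self_eq_norm_sq_to_K]
    norm_cast
  let E : {s : ℝ // 0 < s} → Submodule ℂ H := fun s =>
    eigenspace (T : H →ₗ[ℂ] H) (((s : ℝ) ^ 2 : ℝ) : ℂ)
  have hfd : ∀ s, FiniteDimensional ℂ (E s) := fun s =>
    finite_dimensional_eigenspace hTc _ (by exact_mod_cast (pow_pos s.2 2).ne')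
  have hmult : ∀ s : {s : ℝ // 0 < s}, singularMultiplicity A s = Module.finrank ℂ (E s) := fun s => by
    rw [singularMultiplicity, eigenspace_abs_eq A s.2]
  let b : ∀ s, OrthonormalBasis (Fin (Module.finrank ℂ (E s))) ℂ (E s) := fun s =>
    stdOrthonormalBasis ℂ (E s)
  have hinj : Function.Injective fun s : {s : ℝ // 0 < s} => (((s : ℝ) ^ 2 : ℝ) : ℂ) := by
    intro s t h
    have : (s : ℝ) ^ 2 = (t : ℝ) ^ 2 := Complex.ofReal_injective h
    exact Subtype.ext ((pow_left_inj₀ s.2.le t.2.le two_ne_zero).mp this)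
  have hE : OrthogonalFamily ℂ (fun s => E s) fun s => (E s).subtypeₗᵢ :=
    hTs.orthogonalFamily_eigenspaces.comp hinj
  let u : (Σ s : {s : ℝ // 0 < s}, Fin (Module.finrank ℂ (E s))) → H := fun p => b p.1 p.2
  have hu : Orthonormal ℂ u := hE.orthonormal_sigma_orthonormal fun s => (b s).orthonormal
  have hnorm : ∀ p, ‖A (u p)‖ = (p.1 : ℝ) := by
    intro p
    have h1 : T (u p) = (((p.1 : ℝ) ^ 2 : ℝ) : ℂ) • u p :=
      mem_eigenspace_iff.mp (b p.1 p.2).2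
    have h2 := hAT (u p)
    rw [h1, inner_smul_right, inner_self_eq_norm_sq_to_K, hu.1 p] at h2
    have h3 : (p.1 : ℝ) ^ 2 = ‖A (u p)‖ ^ 2 := by
      apply Complex.ofReal_injective
      simpa using h2
    exact ((pow_left_inj₀ p.1.2.le (norm_nonneg _) two_ne_zero).mp h3).symm
  -- The spectral theorem for the compact operator `T`: `v` minus its projection to `ker T` is
  -- orthogonal to every eigenspace, hence zero.
  have hker : ∀ v, (∀ p, inner ℂ (u p) v = 0) → A v = 0 := by
    intro v hv
    let N := LinearMap.ker (T : H →ₗ[ℂ] H)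
    have hNc : IsClosed (N : Set H) := T.isClosed_ker
    have : CompleteSpace N := hNc.completeSpace_coe
    have hEv : ∀ s, v ∈ (E s)ᗮ := by
      intro s w hw
      have : w = ∑ j, inner ℂ (b s j) ⟨w, hw⟩ • (b s j : H) := by
        have := congrArg Subtype.val ((b s).sum_repr' ⟨w, hw⟩)
        simpa using this.symm
      rw [this, sum_inner]
      exact Finset.sum_eq_zero fun j _ => by
        rw [inner_smul_left, hv ⟨s, j⟩, mul_zero]
    set w := v - N.starProjection v with hw
    have hN : T (N.starProjection v) = 0 := N.starProjection_apply_mem v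
    have h0 : w ∈ (⨆ μ, eigenspace (T : H →ₗ[ℂ] H) μ)ᗮ := by
      rw [← Submodule.iInf_orthogonal, Submodule.mem_iInf]
      intro μ z hz
      have hTz : T z = μ • z := mem_eigenspace_iff.mp hz
      rcases eq_or_ne z 0 with rfl | hz0
      · exact inner_zero_left _
      rcases eq_or_ne μ 0 with rfl | hμ
      · have hzN : z ∈ N := LinearMap.mem_ker.mpr (by simpa using hTz)
        exact N.sub_starProjection_mem_orthogonal v z hzN
      -- A nonzero eigenvalue of `T` is the square of the positive number `‖A z‖ / ‖z‖`, so its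
      -- eigenspace is among the `E s`.
      have hμr : μ = ((‖A z‖ ^ 2 / ‖z‖ ^ 2 : ℝ) : ℂ) := by
        have := hAT z
        rw [hTz, inner_smul_right, inner_self_eq_norm_sq_to_K] at this
        push_cast
        rw [eq_div_iff (by simpa using hz0)]
        simpa using this
      have hAz : ‖A z‖ ≠ 0 := fun h => hμ (by rw [hμr, h]; simp)
      have hs : 0 < ‖A z‖ / ‖z‖ := by positivity
      have hzE : z ∈ E ⟨_, hs⟩ := by
        rw [mem_eigenspace_iff, div_pow, ← hμr]
        exact hTz
      have h1 : inner ℂ z (N.starProjection v) = 0 := by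
        have h2 := hTs z (N.starProjection v)
        simp only [coe_coe] at h2
        rw [hN, inner_zero_right, hTz, inner_smul_left] at h2
        exact (mul_eq_zero.mp h2).resolve_left (by simpa using hμ)
      rw [hw, inner_sub_right, hEv _ z hzE, h1, sub_zero]
    rw [orthogonalComplement_iSup_eigenspaces_eq_bot hTc hTs, Submodule.mem_bot] at h0
    have h1 : T v = 0 := by 
      rw [hw, sub_eq_zero] at h0
      rw [h0, hN]
    have h2 := hAT v
    rw [h1, inner_zero_right] at h2
    have h3 : ‖A v‖ ^ 2 = 0 := by exact_mod_cast h2.symm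
    exact norm_eq_zero.mp (pow_eq_zero_iff two_ne_zero |>.mp h3)
  refine ⟨_, fun p => A (u p), u, hu, ?_, ?_⟩
  · simp_rw [hnorm]
    rw [summable_sigma_of_nonneg fun p => p.1.2.le]
    refine ⟨fun s => (hasSum_fintype _).summable, hsum.congr fun s => ?_⟩
    rw [tsum_fintype]
    simp [hmult, mul_comm]
  · intro w v
    -- Expand in a Hilbert basis containing `u`; `A` kills the added vectors by `hker`.
    obtain ⟨S, B, hS, hB⟩ := hu.toSubtypeRange.exists_hilbertBasis_extension
    have h1 := B.hasSum_inner_mul_inner (adjoint A w) v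
    simp_rw [hB, adjoint_inner_left] at h1
    let g : Set.range u → S := Set.inclusion hS
    let j : _ → S := g ∘ Set.rangeFactorization u
    have hj : Function.Injective j := (Set.inclusion_injective hS).comp fun p q h =>
      hu.linearIndependent.injective (congrArg Subtype.val h)
    refine (hj.hasSum_iff (f := fun i : S => inner ℂ w (A i) * inner ℂ (i : H) v) ?_).mpr h1
    intro i hi
    have : A (i : H) = 0 := by
      refine hker _ fun p => ?_
      have h2 := B.orthonormal.2 (i := j p) (j := i) fun h => hi ⟨p, h⟩
      rwa [hB] at h2
    rw [this, inner_zero_right, zero_mul]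

/-! ### Uniform bounds, limits and the finite-dimensional determinant. -/

namespace FredholmDet
open scoped Nat
open Filter Topology
section
variable {H : Type*} [NormedAddCommGroup H] [InnerProductSpace ℂ H] {ι κ : Type*}

theorem hasSum_tuple_prod_bound {c : κ → ℝ} (h0 : ∀ k, 0 ≤ c k) (hc : Summable c) (n : ℕ) :
    HasSum (fun k : Fin n → κ => ∏ a, c (k a)) ((∑' k, c k) ^ n) := by
  have h := summable_norm_prod_pi n (fun _ k => (c k : ℂ))
    (fun _ => by simpa [abs_of_nonneg (h0 _)] using hc)
  have h1 : Summable fun k : Fin n → κ => ∏ a, c (k a) := by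
    simpa [abs_of_nonneg (h0 _)] using h.1
  have h2 : ∑' k : Fin n → κ, ∏ a, c (k a) = (∑' k, c k) ^ n := by
    simpa [← Complex.ofReal_prod, ← Complex.ofReal_tsum, ← Complex.ofReal_pow] using h.2
  exact h2 ▸ h1.hasSum

/-- The majorant `c` is kept apart from `x` and `y` so that one choice serves `A` and all its
Galerkin projections. -/
theorem norm_expansionTrace_le {x y : κ → H} {c : κ → ℝ} (h0 : ∀ k, 0 ≤ c k) (hc : Summable c)
    (n : ℕ) (hdet : ∀ k : Fin n → κ,
      ‖Matrix.det (Matrix.of fun a b => inner ℂ (y (k a)) (x (k b)))‖ ≤ ∏ a, c (k a)) :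
    ‖expansionTrace x y n‖ ≤ (∑' k, c k) ^ n / n ! := by
  rw [expansionTrace, norm_mul, norm_inv, Complex.norm_natCast, inv_mul_eq_div]
  gcongr
  exact tsum_of_norm_bounded (hasSum_tuple_prod_bound h0 hc n) hdet

theorem summable_pow_mul_expansionTrace {x y : κ → H} {c : κ → ℝ} (h0 : ∀ k, 0 ≤ c k)
    (hc : Summable c) (hdet : ∀ (n : ℕ) (k : Fin n → κ),
      ‖Matrix.det (Matrix.of fun a b => inner ℂ (y (k a)) (x (k b)))‖ ≤ ∏ a, c (k a)) (z : ℂ) :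
    Summable fun n => z ^ n * expansionTrace x y n := by
  refine Summable.of_norm_bounded (Real.summable_pow_div_factorial (‖z‖ * ∑' k, c k)) fun n => ?_
  rw [norm_mul, norm_pow, mul_pow, mul_div_assoc]
  gcongr
  exact norm_expansionTrace_le h0 hc n (hdet n)

theorem tendsto_expansionTrace {x y : κ → H} {x' y' : ℕ → κ → H} {c : κ → ℝ} (h0 : ∀ k, 0 ≤ c k)
    (hc : Summable c) (n : ℕ) (hdet : ∀ m (k : Fin n → κ),
      ‖Matrix.det (Matrix.of fun a b => inner ℂ (y' m (k a)) (x' m (k b)))‖ ≤ ∏ a, c (k a))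
    (hx : ∀ k, Tendsto (x' · k) atTop (𝓝 (x k))) (hy : ∀ k, Tendsto (y' · k) atTop (𝓝 (y k))) :
    Tendsto (fun m => expansionTrace (x' m) (y' m) n) atTop (𝓝 (expansionTrace x y n)) := by
  refine Tendsto.const_mul _ (tendsto_tsum_of_dominated_convergence
    (hasSum_tuple_prod_bound h0 hc n).summable (fun k => ?_) (Eventually.of_forall hdet))
  simp only [Matrix.det_apply, Matrix.of_apply]
  exact tendsto_finsetSum _ fun σ _ => (tendsto_finsetProd _ fun a _ =>
    (hy _).inner (hx _)).const_smul _

theorem operatorDet_eq [CompleteSpace H] (e : HilbertBasis ι ℂ H) {A : H →L[ℂ] H}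
    {x y : κ → H} (hA : HasExpansion A x y) (hxy : Summable fun k => ‖x k‖ * ‖y k‖) (z : ℂ) :
    operatorDet e A z = ∑' n, z ^ n * expansionTrace x y n :=
  tsum_congr fun n => by rw [traceExteriorPower, (hasSum_principalMinor e hA hxy n).tsum_eq]

theorem operatorDetConverges_of_expansion [CompleteSpace H] (e : HilbertBasis ι ℂ H)
    {A : H →L[ℂ] H} {x y : κ → H} (hA : HasExpansion A x y)
    (hxy : Summable fun k => ‖x k‖ * ‖y k‖) {c : κ → ℝ} (h0 : ∀ k, 0 ≤ c k) (hc : Summable c)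
    (hdet : ∀ (n : ℕ) (k : Fin n → κ),
      ‖Matrix.det (Matrix.of fun a b => inner ℂ (y (k a)) (x (k b)))‖ ≤ ∏ a, c (k a)) :
    OperatorDetConverges e A := by
  refine ⟨fun n => (hasSum_principalMinor e hA hxy n).summable, fun z => ?_⟩
  refine (summable_pow_mul_expansionTrace h0 hc hdet z).congr fun n => ?_
  rw [traceExteriorPower, (hasSum_principalMinor e hA hxy n).tsum_eq]

/-- On `B` the difference is at most `∑ |R|ⁿ ‖d' m n - d n‖`, which is free of `z` and tends to zero
by dominated convergence. -/
theorem tendstoUniformlyOn_tsum_pow_mul {d : ℕ → ℂ} {d' : ℕ → ℕ → ℂ} {C : ℝ}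
    (hd : ∀ n, ‖d n‖ ≤ C ^ n / n !) (hd' : ∀ m n, ‖d' m n‖ ≤ C ^ n / n !)
    (hlim : ∀ n, Tendsto (d' · n) atTop (𝓝 (d n))) {B : Set ℂ} (hB : Bornology.IsBounded B) :
    TendstoUniformlyOn (fun m z => ∑' n, z ^ n * d' m n) (fun z => ∑' n, z ^ n * d n) atTop B := by
  obtain ⟨R, hR⟩ := hB.exists_norm_le
  -- `R` may be negative when `B` is empty.
  have hR' : ∀ z ∈ B, ‖z‖ ≤ |R| := fun z hz => (hR z hz).trans (le_abs_self R)
  have hbd : ∀ f : ℕ → ℂ, (∀ n, ‖f n‖ ≤ C ^ n / n !) → ∀ n,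
      |R| ^ n * ‖f n‖ ≤ (|R| * C) ^ n / n ! := fun f hf n => by
    rw [mul_pow, mul_div_assoc]
    gcongr
    exact hf n
  have hs : ∀ f : ℕ → ℂ, (∀ n, ‖f n‖ ≤ C ^ n / n !) → Summable fun n => |R| ^ n * ‖f n‖ :=
    fun f hf => (Real.summable_pow_div_factorial (|R| * C)).of_nonneg_of_le
      (fun n => by positivity) (hbd f hf)
  have hsz : ∀ f : ℕ → ℂ, (∀ n, ‖f n‖ ≤ C ^ n / n !) → ∀ z ∈ B,
      Summable fun n => z ^ n * f n := fun f hf z hz =>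
    Summable.of_norm_bounded (hs f hf) fun n => by
      rw [norm_mul, norm_pow]
      gcongr
      exact hR' z hz
  have hdiff : ∀ m n, |R| ^ n * ‖d' m n - d n‖ ≤ 2 * ((|R| * C) ^ n / n !) := fun m n =>
    calc |R| ^ n * ‖d' m n - d n‖ ≤ |R| ^ n * (‖d' m n‖ + ‖d n‖) := by
          gcongr
          exact norm_sub_le _ _
      _ ≤ 2 * ((|R| * C) ^ n / n !) := by
          linarith [hbd _ (hd' m) n, hbd _ hd n]
  have hs2 := (Real.summable_pow_div_factorial (|R| * C)).mul_left 2
  have hT : Tendsto (fun m => ∑' n, |R| ^ n * ‖d' m n - d n‖) atTop (𝓝 0) := by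
    have := tendsto_tsum_of_dominated_convergence (𝓕 := atTop)
      (f := fun m n => |R| ^ n * ‖d' m n - d n‖) (g := fun _ => (0 : ℝ)) hs2 (fun n => by
        have := (((hlim n).sub_const (d n)).norm).const_mul (|R| ^ n)
        simpa using this) (Eventually.of_forall fun m n => by
        rw [Real.norm_of_nonneg (by positivity)]
        exact hdiff m n)
    simpa using this
  rw [Metric.tendstoUniformlyOn_iff]
  intro ε hε
  filter_upwards [hT.eventually_lt_const hε] with m hm z hz
  refine lt_of_le_of_lt ?_ hm
  rw [dist_comm, dist_eq_norm, ← (hsz _ (hd' m) z hz).tsum_sub (hsz _ hd z hz)]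
  refine tsum_of_norm_bounded (Summable.hasSum (hs2.of_nonneg_of_le
    (fun n => by positivity) (hdiff m))) fun n => ?_
  rw [← mul_sub, norm_mul, norm_pow]
  gcongr
  exact hR' z hz

theorem HasExpansion.galerkinProjection {A : H →L[ℂ] H} {x y : κ → H} (hA : HasExpansion A x y)
    (V : Submodule ℂ H) [V.HasOrthogonalProjection] :
    HasExpansion (galerkinProjection V A) (fun k => V.starProjection (x k))
      (fun k => V.starProjection (y k)) := by
  intro w v
  simpa [FredholmDet.galerkinProjection, Submodule.inner_starProjection_left_eq_right] using
    hA (V.starProjection w) (V.starProjection v)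

theorem HasExpansion.compression {A : H →L[ℂ] H} {x y : κ → H} (hA : HasExpansion A x y)
    (V : Submodule ℂ H) [V.HasOrthogonalProjection] :
    HasExpansion (V.orthogonalProjectionOnto ∘L A ∘L V.subtypeL)
      (fun k => V.orthogonalProjectionOnto (x k)) (fun k => V.orthogonalProjectionOnto (y k)) := by
  intro w v
  simpa using hA (w : H) (v : H)

/-- The coefficients of the polynomial `det (1 + X M)` are the sums of principal minors of `M`. -/
theorem operatorDet_of_fintype [CompleteSpace H] {n : Type*} [Fintype n] [DecidableEq n]
    (e : HilbertBasis n ℂ H) (A : H →L[ℂ] H) (z : ℂ) :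
    operatorDet e A z = Matrix.det (1 + z • Matrix.of fun i j => inner ℂ (e i) (A (e j))) := by
  let M : Matrix n n ℂ := Matrix.of fun i j => inner ℂ (e i) (A (e j))
  let p : Polynomial ℂ := Matrix.det (1 + (Polynomial.X : Polynomial ℂ) • M.map Polynomial.C)
  have hcoeff : ∀ k, traceExteriorPower e A k = p.coeff k := by
    intro k
    rw [Matrix.coeff_det_one_add_X_smul_eq_sum_minors, traceExteriorPower]
    have hS : ∀ s : Finset n, (M.submatrix (Subtype.val : s → n) Subtype.val).det =
        principalMinor e A s := fun s => by
      rw [principalMinor]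
      congr!
    simp_rw [hS]
    rw [← Finset.tsum_subtype]
    refine ((Equiv.subtypeEquivRight fun s => ?_).tsum_eq _).symm
    simp [Set.powersetCard]
  have heval : Polynomial.eval z p = Matrix.det (1 + z • M) := by
    rw [← Polynomial.coe_evalRingHom, RingHom.map_det]
    congr 1
    ext i j
    by_cases h : i = j <;> simp [h, mul_comm z]
  rw [← heval, Polynomial.eval_eq_sum_range, operatorDet]
  simp_rw [hcoeff]
  rw [tsum_eq_sum (s := Finset.range (p.natDegree + 1))]
  · exact Finset.sum_congr rfl fun _ _ => mul_comm _ _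
  · intro k hk
    rw [Polynomial.coeff_eq_zero_of_natDegree_lt (by simpa using hk), mul_zero]

end
end FredholmDet

/-! ### Convergence of the Galerkin determinants. -/

open Filter Topology FredholmDet in
theorem theorem5p1 {H : Type*} [NormedAddCommGroup H] [InnerProductSpace ℂ H] [CompleteSpace H]
    [TopologicalSpace.SeparableSpace H]
    {ι : Type*} (e : HilbertBasis ι ℂ H)
    (A : H →L[ℂ] H) (hA : FredholmDet.IsTraceClass A)
    (V : ℕ → Submodule ℂ H) [∀ m, FiniteDimensional ℂ (V m)]
    (hdense : Dense (⋃ m, (V m : Set H)))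
    (hV : Monotone V ∨
      ∀ x : H, Filter.Tendsto (fun m => (V m).starProjection x) Filter.atTop (nhds x)) :
    FredholmDet.OperatorDetConverges e A ∧
    (∀ m, FredholmDet.OperatorDetConverges e (FredholmDet.galerkinProjection (V m) A)) ∧
    (∀ (m d : ℕ) (φ : OrthonormalBasis (Fin d) ℂ (V m)) (z : ℂ),
      FredholmDet.operatorDet e (FredholmDet.galerkinProjection (V m) A) z =
        Matrix.det (Matrix.of fun i j : Fin d =>
          (if i = j then 1 else 0) + z * inner ℂ (φ i : H) (A (φ j : H)))) ∧
    ∀ B : Set ℂ, Bornology.IsBounded B →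
      TendstoUniformlyOn
        (fun m z => FredholmDet.operatorDet e (FredholmDet.galerkinProjection (V m) A) z)
        (fun z => FredholmDet.operatorDet e A z) Filter.atTop B := by
  have hlim : ∀ x : H, Tendsto (fun m => (V m).starProjection x) atTop (𝓝 x) := by
    rcases hV with hV | hV
    · intro x
      refine Submodule.starProjection_tendsto_self V hV x fun v _ => ?_
      refine closure_mono ?_ (hdense v)
      exact Set.iUnion_subset fun m => le_iSup V m
    · exact hV
  obtain ⟨κ, x, u, hu, hx, hexp⟩ := hA.exists_expansion
  have h0 : ∀ k, 0 ≤ ‖x k‖ := fun k => norm_nonneg _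
  have hxu : Summable fun k => ‖x k‖ * ‖u k‖ := by simpa [hu.1] using hx
  have hPx : ∀ (m : ℕ) k, ‖(V m).starProjection (x k)‖ ≤ ‖x k‖ := fun m k =>
    (V m).norm_starProjection_apply_le (x k)
  have hPxu : ∀ m, Summable fun k => ‖(V m).starProjection (x k)‖ * ‖(V m).starProjection (u k)‖ :=
    fun m => hxu.of_nonneg_of_le (fun k => by positivity) fun k =>
      mul_le_mul (hPx m k) ((V m).norm_starProjection_apply_le (u k)) (norm_nonneg _) (norm_nonneg _)
  have hdet : ∀ (n : ℕ) (k : Fin n → κ),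
      ‖Matrix.det (Matrix.of fun a b => inner ℂ (u (k a)) (x (k b)))‖ ≤ ∏ a, ‖x (k a)‖ :=
    fun n k => hu.norm_det_inner_le x k
  have hPdet : ∀ (m n : ℕ) (k : Fin n → κ), ‖Matrix.det (Matrix.of fun a b =>
      inner ℂ ((V m).starProjection (u (k a))) ((V m).starProjection (x (k b))))‖ ≤
      ∏ a, ‖x (k a)‖ := by
    intro m n k
    refine le_trans ?_ ((hu.norm_det_inner_le (fun k => (V m).starProjection (x k)) k).trans
      (Finset.prod_le_prod (fun _ _ => norm_nonneg _) fun a _ => hPx m (k a)))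
    -- Moving `P` off `u` keeps that system orthonormal; `P` is self-adjoint and idempotent.
    refine le_of_eq (congrArg (fun M => ‖Matrix.det M‖) ?_)
    ext a b
    simp only [Matrix.of_apply, Submodule.inner_starProjection_left_eq_right]
    rw [(V m).starProjection_eq_self_iff.mpr ((V m).starProjection_apply_mem _)]
  have hPexp := fun m => hexp.galerkinProjection (V m)
  refine ⟨operatorDetConverges_of_expansion e hexp hxu h0 hx hdet,
    fun m => operatorDetConverges_of_expansion e (hPexp m) (hPxu m) h0 hx (hPdet m), ?_, ?_⟩
  · intro m d φ z
    have hφ := operatorDet_of_fintype φ.toHilbertBasis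
      ((V m).orthogonalProjectionOnto ∘L A ∘L (V m).subtypeL) z
    rw [operatorDet_eq φ.toHilbertBasis (hexp.compression (V m)) (hPxu m) z] at hφ
    rw [operatorDet_eq e (hPexp m) (hPxu m) z]
    refine Eq.trans ?_ (hφ.trans (congrArg Matrix.det ?_))
    -- The inner product of `V m` is that of `H`, so both expansions have the same Gram
    -- determinants.
    · rfl
    · ext i j
      simp [Matrix.one_apply]
  · intro B hB
    simp_rw [operatorDet_eq e hexp hxu, fun m => operatorDet_eq e (hPexp m) (hPxu m)]
    exact tendstoUniformlyOn_tsum_pow_mul (fun n => norm_expansionTrace_le h0 hx n (hdet n))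
      (fun m n => norm_expansionTrace_le h0 hx n (hPdet m n))
      (fun n => tendsto_expansionTrace h0 hx n (fun m => hPdet m n) (fun k => hlim (x k))
        fun k => hlim (u k)) hB
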